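/- Let $k$ be a field. An evolution algebra over $k$ is a finite-dimensional $k$-vector space $X$ with a $k$-bilinear product that has a natural basis, that is, a basis $B$ with $bb'=0$ for all distinct $b,b'\in B$. It is idempotent if the products $xy$ ($x,y\in X$) span $X$. A natural idempotent of $X$ is an element $x$ with $x^2=x$ that belongs to some natural basis of $X$. The group $\operatorname{Aut}(X)$ of $k$-algebra automorphisms of $X$ permutes the set $\widetilde{B}_X$ of natural idempotents of $X$; let $\widetilde\rho_X\colon \operatorname{Aut}(X)\to \operatorname{Sym}(\widetilde{B}_X)$ be the resulting permutation representation. Theorem. Let $k$ be any field, $G$ a finite group, $V$ a finite non-empty set, and $\xi\colon G\to\operatorname{Sym}(V)$ a group homomorphism (not necessarily injective). Then there are infinitely many pairwise non-isomorphic idempotent evolution $k$-algebras $X$ for each of which there exist a group isomorphism $\varphi\colon G\to\operatorname{Aut}(X)$ and a bijection $e\colon V\to\widetilde{B}_X$ such that $\widetilde\rho_X(\varphi(g))(e(v))=e(\xi(g)(v))$ for all $g\in G$ and $v\in V$. -/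

import Mathlib

universe u v w

namespace EvolutionAlgebra

section Notions

variable (k : Type*) [Field k] (X : Type*) [NonUnitalNonAssocRing X] [Module k X]

/-- A subset `B` of a (not necessarily associative or unital) `k`-algebra `X` is a natural basis
if it is a `k`-basis of `X` and the product of any two distinct elements of `B` vanishes. -/
structure IsNaturalBasis (B : Set X) : Prop where
  linearIndepOn : LinearIndepOn k id B
  span_eq_top : Submodule.span k B = ⊤
  mul_eq_zero : ∀ x ∈ B, ∀ y ∈ B, x ≠ y → x * y = 0

/-- The algebra `X` is idempotent (perfect) if `X² = X`, where `X²` is the linear span of all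
products of two elements. -/
def IsIdempotentAlgebra : Prop :=
  Submodule.span k {z : X | ∃ x y : X, z = x * y} = ⊤

/-- A natural element is an element of some natural basis. -/
def IsNaturalElement (x : X) : Prop :=
  ∃ B : Set X, IsNaturalBasis k X B ∧ x ∈ B

/-- The set of all natural idempotent elements of `X`. -/
def naturalIdempotents : Set X :=
  {x | IsNaturalElement k X x ∧ x * x = x}

/-- The group `Aut(X)` of `k`-algebra automorphisms of `X`, that is, of the bijective `k`-linear
maps `X → X` that preserve the product; the group operation is composition. -/
def Aut : Subgroup (X ≃ₗ[k] X) where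
  carrier := {f | ∀ x y : X, f (x * y) = f x * f y}
  one_mem' := fun _ _ => rfl
  mul_mem' := by
    intro f g hf hg x y
    simp only [Set.mem_ofPred_eq] at hf hg
    simp only [LinearEquiv.mul_apply, hg, hf]
  inv_mem' := by
    intro f hf x y
    apply f.injective
    have h := hf (f⁻¹ x) (f⁻¹ y)
    have e : ∀ z, f (f⁻¹ z) = z := fun z => f.apply_symm_apply z
    rw [h, e, e, e]

/-- Two `k`-algebras are isomorphic if there is a bijective `k`-linear map between them that
preserves the product. -/
def Isomorphic (Y : Type*) [NonUnitalNonAssocRing Y] [Module k Y] : Prop :=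
  ∃ f : X ≃ₗ[k] Y, ∀ x y : X, f (x * y) = f x * f y

variable {k X}

theorem IsNaturalBasis.image {B : Set X} (hB : IsNaturalBasis k X B) (f : Aut k X) :
    IsNaturalBasis k X ((f : X ≃ₗ[k] X) '' B) where
  linearIndepOn := by
    have h := hB.linearIndepOn.map_injOn ((f : X ≃ₗ[k] X) : X →ₗ[k] X)
      ((f : X ≃ₗ[k] X).injective.injOn)
    exact h.id_image
  span_eq_top := by
    have h := Submodule.map_span ((f : X ≃ₗ[k] X) : X →ₗ[k] X) B
    rw [hB.span_eq_top, Submodule.map_top, LinearEquiv.range] at h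
    exact h.symm
  mul_eq_zero := by
    rintro _ ⟨x, hx, rfl⟩ _ ⟨y, hy, rfl⟩ hxy
    have h := f.2 x y
    rw [← h, hB.mul_eq_zero x hx y hy (fun e => hxy (by rw [e])), map_zero]

theorem apply_mem_naturalIdempotents (f : Aut k X) {x : X} (hx : x ∈ naturalIdempotents k X) :
    (f : X ≃ₗ[k] X) x ∈ naturalIdempotents k X := by
  obtain ⟨⟨B, hB, hxB⟩, hxx⟩ := hx
  refine ⟨⟨_, hB.image f, x, hxB, rfl⟩, ?_⟩
  have h := f.2 x x
  rw [← h, hxx]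

/-- `Aut(X)` acts on the set of natural idempotents by evaluation. -/
instance : MulAction (Aut k X) (naturalIdempotents k X) where
  smul f x := ⟨(f : X ≃ₗ[k] X) x, apply_mem_naturalIdempotents f x.2⟩
  one_smul _ := rfl
  mul_smul _ _ _ := rfl

variable (k X)

/-- The permutation representation of `Aut(X)` on the set of natural idempotents of `X`. -/
def naturalIdempotentRep : Aut k X →* Equiv.Perm (naturalIdempotents k X) :=
  MulAction.toPermHom (Aut k X) (naturalIdempotents k X)

end Notions

end EvolutionAlgebra

/-- An evolution algebra over the field `k`: a finite-dimensional `k`-algebra (a vector space with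
a bilinear product) that possesses a natural basis. -/
structure EvolutionAlgebra (k : Type u) [Field k] where
  carrier : Type u
  [ring : NonUnitalNonAssocRing carrier]
  [module : Module k carrier]
  [isScalarTower : IsScalarTower k carrier carrier]
  [smulCommClass : SMulCommClass k carrier carrier]
  [finite : Module.Finite k carrier]
  exists_naturalBasis : ∃ B : Set carrier, EvolutionAlgebra.IsNaturalBasis k carrier B

attribute [instance] EvolutionAlgebra.ring EvolutionAlgebra.module
  EvolutionAlgebra.isScalarTower EvolutionAlgebra.smulCommClass EvolutionAlgebra.finite

/-! A finite acyclic relation `R` gives an algebra with e_i² = e_i + ∑ e_j over the out-neighbours j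
of i. Along a height function the matrix of squares is unitriangular, hence invertible over any
field. So the algebra is idempotent, and its natural elements are the nonzero multiples of the e_i
(`exists_eq_smul_stdBasis`). The diagonal entries 1 force c² = c on the scalars of automorphisms and
natural idempotents, so c = 1: automorphisms of the algebra are those of `R` (`exists_eq_permute`),
and natural idempotents are its sinks.

It remains to realise the action by an acyclic relation with sinks `V`. Stack `N` copies of `G` over
`V`, joined by vertical edges; the label of each layer encodes a right multiplication g ↦ g h or an
orbit map g ↦ g • u. An automorphism preserves heights, acts alike on all copies and commutes with
right multiplications, so it is a left translation; the orbit maps then fix it on `V`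
(`exists_eq_layeredAction`). Since `G` acts freely on its copies, `ξ` need not be injective. Varying
`N` varies the dimension |V| + |G| N. -/

namespace EvolutionAlgebra

/-! ### The algebra of a relation -/

open scoped Classical in
/-- The linear endomorphism of `ι → k` sending the `i`-th basis vector to the sum of itself and
of the basis vectors at the out-neighbours of `i`. -/
noncomputable def neighbourSum (k : Type*) [Field k] {ι : Type*} [Fintype ι] (R : ι → ι → Prop) :
    (ι → k) →ₗ[k] (ι → k) where
  toFun x := fun j => x j + ∑ i, if R i j then x i else 0
  map_add' x y := by
    funext j
    simp only [Pi.add_apply]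
    rw [add_add_add_comm, ← Finset.sum_add_distrib]
    congr 1
    exact Finset.sum_congr rfl fun i _ => by split_ifs <;> simp
  map_smul' c x := by
    funext j
    simp only [Pi.smul_apply, smul_eq_mul, RingHom.id_apply, mul_add, Finset.mul_sum, mul_ite,
      mul_zero]

/-- The evolution algebra of a relation `R`: the square of the `i`-th basis vector is
the sum of itself and of the basis vectors at the out-neighbours of `i`. -/
def RelAlgebra (k : Type*) {ι : Type*} (_R : ι → ι → Prop) := ι → k

namespace RelAlgebra

variable {k : Type*} [Field k] {ι : Type*} {R : ι → ι → Prop}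

instance : AddCommGroup (RelAlgebra k R) := inferInstanceAs (AddCommGroup (ι → k))

instance : Module k (RelAlgebra k R) := inferInstanceAs (Module k (ι → k))

instance : CoeFun (RelAlgebra k R) fun _ => ι → k := ⟨fun x => x⟩

/-- Permutation of coordinates, as a linear equivalence. -/
def permute (R : ι → ι → Prop) (σ : Equiv.Perm ι) : RelAlgebra k R ≃ₗ[k] RelAlgebra k R :=
  LinearEquiv.funCongrLeft k k σ.symm

theorem permute_apply (σ : Equiv.Perm ι) (x : RelAlgebra k R) (i : ι) :
    permute R σ x i = x (σ.symm i) := rfl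

variable [Fintype ι]

instance : Module.Finite k (RelAlgebra k R) := inferInstanceAs (Module.Finite k (ι → k))

/-- The coordinatewise product of two vectors. -/
def hadamard (x y : RelAlgebra k R) : ι → k := fun i => x i * y i

noncomputable instance : Mul (RelAlgebra k R) :=
  ⟨fun x y => neighbourSum k R (hadamard x y)⟩

theorem mul_def (x y : RelAlgebra k R) : x * y = neighbourSum k R (hadamard x y) := rfl

noncomputable instance : NonUnitalNonAssocRing (RelAlgebra k R) where
  __ := (inferInstance : AddCommGroup (RelAlgebra k R))
  __ := (inferInstance : Mul (RelAlgebra k R))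
  left_distrib x y z := by
    have h : hadamard x (y + z) = hadamard x y + hadamard x z := funext fun i => mul_add _ _ _
    change neighbourSum k R _ = neighbourSum k R _ + neighbourSum k R _
    rw [h, map_add]
  right_distrib x y z := by
    have h : hadamard (x + y) z = hadamard x z + hadamard y z := funext fun i => add_mul _ _ _
    change neighbourSum k R _ = neighbourSum k R _ + neighbourSum k R _
    rw [h, map_add]
  zero_mul x := by
    have h : hadamard (0 : RelAlgebra k R) x = 0 := funext fun i => zero_mul _
    change neighbourSum k R _ = 0
    rw [h, map_zero]
  mul_zero x := by
    have h : hadamard x (0 : RelAlgebra k R) = 0 := funext fun i => mul_zero _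
    change neighbourSum k R _ = 0
    rw [h, map_zero]

instance : IsScalarTower k (RelAlgebra k R) (RelAlgebra k R) where
  smul_assoc c x y := by
    have h : hadamard (c • x) y = c • hadamard x y := funext fun i => mul_assoc _ _ _
    change neighbourSum k R _ = c • neighbourSum k R _
    rw [h, map_smul]

instance : SMulCommClass k (RelAlgebra k R) (RelAlgebra k R) where
  smul_comm c x y := by
    have h : hadamard x (c • y) = c • hadamard x y := funext fun i => mul_left_comm _ _ _
    change c • neighbourSum k R _ = neighbourSum k R _
    rw [h, map_smul]

open scoped Classical in
/-- The standard basis. -/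
noncomputable def stdBasis : Module.Basis ι k (RelAlgebra k R) := Pi.basisFun k ι

theorem repr_eq (x : RelAlgebra k R) (i : ι) : stdBasis.repr x i = x i := by
  classical
  exact Pi.basisFun_repr (R := k) (η := ι) x i

open scoped Classical in
theorem stdBasis_apply (i j : ι) :
    (stdBasis i : RelAlgebra k R) j = if i = j then 1 else 0 := by
  rw [← repr_eq (stdBasis i) j, Module.Basis.repr_self, Finsupp.single_apply]

theorem stdBasis_self (i : ι) : (stdBasis i : RelAlgebra k R) i = 1 := by
  classical
  rw [stdBasis_apply, if_pos rfl]

theorem stdBasis_of_ne {i j : ι} (h : i ≠ j) : (stdBasis i : RelAlgebra k R) j = 0 := by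
  classical
  rw [stdBasis_apply, if_neg h]

theorem hadamard_stdBasis (i : ι) :
    hadamard (stdBasis i : RelAlgebra k R) (stdBasis i) = (stdBasis i : RelAlgebra k R) := by
  classical
  funext j
  simp only [hadamard]
  rw [stdBasis_apply]
  split_ifs <;> simp

theorem stdBasis_mul_of_ne {i j : ι} (h : i ≠ j) :
    (stdBasis i : RelAlgebra k R) * stdBasis j = 0 := by
  classical
  have h0 : hadamard (stdBasis i : RelAlgebra k R) (stdBasis j) = 0 := by
    funext l
    simp only [hadamard]
    rw [stdBasis_apply, stdBasis_apply]
    by_cases hi : i = l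
    · subst hi
      simp [h.symm]
    · simp [hi]
  rw [mul_def, h0, map_zero]
  rfl

open scoped Classical in
theorem stdBasis_mul_self_apply (i j : ι) :
    (stdBasis i * stdBasis i : RelAlgebra k R) j =
      (if i = j then 1 else 0) + if R i j then 1 else 0 := by
  rw [mul_def, hadamard_stdBasis]
  change (stdBasis i : RelAlgebra k R) j +
    ∑ l, (if R l j then (stdBasis i : RelAlgebra k R) l else 0) = _
  rw [stdBasis_apply]
  congr 1
  rw [Finset.sum_eq_single i]
  · rw [stdBasis_self]
  · intro l _ hl
    rw [stdBasis_of_ne hl.symm, ite_self]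
  · simp

theorem isNaturalBasis_range_stdBasis :
    IsNaturalBasis k (RelAlgebra k R) (Set.range stdBasis) where
  linearIndepOn := (stdBasis (R := R)).linearIndependent.linearIndepOn_id
  span_eq_top := stdBasis.span_eq
  mul_eq_zero := by
    rintro _ ⟨i, rfl⟩ _ ⟨j, rfl⟩ h
    exact stdBasis_mul_of_ne fun e => h (by rw [e])


/-! ### Idempotency, natural elements and natural idempotents -/

/-- A relation along which a height function strictly decreases has an injective
neighbour sum. -/
theorem neighbourSum_injective (ℓ : ι → ℕ) (hℓ : ∀ i j, R i j → ℓ j < ℓ i) :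
    Function.Injective (neighbourSum k R) := by
  classical
  rw [← LinearMap.ker_eq_bot, LinearMap.ker_eq_bot']
  intro x hx
  obtain ⟨M, hM⟩ : ∃ M, ∀ i, ℓ i ≤ M :=
    ⟨∑ i, ℓ i, fun i => Finset.single_le_sum (fun _ _ => Nat.zero_le _) (Finset.mem_univ i)⟩
  -- Induction from the top height down: the in-neighbours of `j` are strictly higher, so only the
  -- term `x j` survives.
  have key : ∀ n j, M - ℓ j = n → x j = 0 := by
    intro n
    induction n using Nat.strong_induction_on with
    | _ n ih =>
      intro j hj
      have h : x j + ∑ i, (if R i j then x i else 0) = 0 := congrFun hx j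
      rwa [Finset.sum_eq_zero, add_zero] at h
      intro i _
      split_ifs with hR
      · have h1 := hℓ i j hR
        have h2 := hM i
        exact ih (M - ℓ i) (by omega) i rfl
      · rfl
  exact funext fun j => key _ j rfl

/-- In finite dimension injectivity gives surjectivity, and the neighbour sum of `x` is the product
of `x` with the all-ones vector. -/
theorem isIdempotentAlgebra (hinj : Function.Injective (neighbourSum k R)) :
    IsIdempotentAlgebra k (RelAlgebra k R) := by
  have hsurj := LinearMap.injective_iff_surjective.mp hinj
  refine Submodule.eq_top_iff'.mpr fun z => ?_
  obtain ⟨x, rfl⟩ := hsurj z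
  have h : x = hadamard (R := R) x (fun _ => 1) := funext fun i => (mul_one _).symm
  exact Submodule.subset_span ⟨x, fun _ => 1, congrArg (neighbourSum k R) h⟩

/-- Every natural element is a nonzero multiple of a standard basis vector. -/
theorem exists_eq_smul_stdBasis (hinj : Function.Injective (neighbourSum k R))
    {x : RelAlgebra k R} (hx : IsNaturalElement k (RelAlgebra k R) x) :
    ∃ i, ∃ c : k, c ≠ 0 ∧ x = c • stdBasis i := by
  obtain ⟨B, hB, hxB⟩ := hx
  have hx0 : x ≠ 0 := hB.linearIndepOn.ne_zero hxB
  obtain ⟨i, hi⟩ : ∃ i, x i ≠ 0 := by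
    by_contra! h
    exact hx0 (funext h)
  have hdisj : ∀ y ∈ B, y ≠ x → ∀ j, x j ≠ 0 → y j = 0 := by
    intro y hy hyx j hj
    have h0 : neighbourSum k R (hadamard x y) = neighbourSum k R 0 := by
      rw [map_zero]
      exact hB.mul_eq_zero x hxB y hy hyx.symm
    exact (mul_eq_zero.mp (congrFun (hinj h0) j)).resolve_left hj
  have hsupp : ∀ j, j ≠ i → x j = 0 := by
    intro j hji
    by_contra hj
    -- This functional kills `x` by antisymmetry and the rest of `B` by disjointness of supports,
    -- yet takes the value `x j ≠ 0` at e_i.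
    let φ : RelAlgebra k R →ₗ[k] k :=
      x j • stdBasis.coord i - x i • stdBasis.coord j
    have hφ (y : RelAlgebra k R) : φ y = x j * y i - x i * y j := by
      simp [φ, repr_eq]
    have h0 : φ = 0 := by
      refine LinearMap.ext_on hB.span_eq_top fun y hy => ?_
      rw [hφ, LinearMap.zero_apply]
      by_cases hyx : y = x
      · rw [hyx, mul_comm, sub_self]
      · rw [hdisj y hy hyx i hi, hdisj y hy hyx j hj, mul_zero, mul_zero, sub_zero]
    have h1 := hφ (stdBasis i)
    rw [h0, stdBasis_self, stdBasis_of_ne hji.symm] at h1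
    simp only [LinearMap.zero_apply, mul_one, mul_zero, sub_zero] at h1
    exact hj h1.symm
  refine ⟨i, x i, hi, funext fun j => ?_⟩
  change x j = x i * (stdBasis i : RelAlgebra k R) j
  by_cases h : j = i
  · rw [h, stdBasis_self, mul_one]
  · rw [hsupp j h, stdBasis_of_ne (Ne.symm h), mul_zero]

/-- The natural idempotents are the basis vectors at the sinks of the relation. -/
theorem mem_naturalIdempotents_iff (hirr : ∀ i, ¬ R i i)
    (hinj : Function.Injective (neighbourSum k R)) {x : RelAlgebra k R} :
    x ∈ naturalIdempotents k (RelAlgebra k R) ↔ ∃ i, (∀ j, ¬ R i j) ∧ stdBasis i = x := by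
  classical
  constructor
  · rintro ⟨hx, hxx⟩
    obtain ⟨i, c, hc, rfl⟩ := exists_eq_smul_stdBasis hinj hx
    have h (j : ι) : c * (c * ((if i = j then 1 else 0) + if R i j then 1 else 0)) =
        c * if i = j then 1 else 0 := by
      have h := congrFun hxx j
      rw [smul_mul_assoc, mul_smul_comm] at h
      change c * (c * (stdBasis i * stdBasis i : RelAlgebra k R) j) =
        c * (stdBasis i : RelAlgebra k R) j at h
      rwa [stdBasis_mul_self_apply, stdBasis_apply] at h
    have hc1 : c = 1 := by
      have h := h i
      simp only [if_true, hirr i, if_false, add_zero, mul_one] at h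
      exact mul_left_cancel₀ hc (h.trans (mul_one c).symm)
    refine ⟨i, fun j hj => ?_, by rw [hc1, one_smul]⟩
    have hij : i ≠ j := fun e => hirr j (e ▸ hj)
    have h := h j
    simp [hc1, hij, hj] at h
  · rintro ⟨i, hi, rfl⟩
    refine ⟨⟨_, isNaturalBasis_range_stdBasis, i, rfl⟩, funext fun j => ?_⟩
    rw [stdBasis_mul_self_apply, stdBasis_apply, if_neg (hi j), add_zero]

/-! ### Automorphisms of the algebra -/

theorem permute_stdBasis (σ : Equiv.Perm ι) (i : ι) :
    permute R σ (stdBasis i : RelAlgebra k R) = stdBasis (σ i) := by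
  classical
  funext j
  rw [permute_apply, stdBasis_apply, stdBasis_apply]
  simp only [Equiv.eq_symm_apply]

theorem permute_mem_aut {σ : Equiv.Perm ι} (hσ : ∀ i j, R (σ i) (σ j) ↔ R i j) :
    permute R σ ∈ Aut k (RelAlgebra k R) := by
  classical
  intro x y
  funext j
  change x (σ.symm j) * y (σ.symm j) + ∑ i, (if R i (σ.symm j) then x i * y i else 0) =
    x (σ.symm j) * y (σ.symm j) +
      ∑ i, (if R i j then x (σ.symm i) * y (σ.symm i) else 0)
  congr 1
  refine Fintype.sum_equiv σ _ _ fun i => ?_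
  have h := hσ i (σ.symm j)
  rw [Equiv.apply_symm_apply] at h
  simp only [h, Equiv.symm_apply_apply]

/-- Every automorphism permutes the standard basis and preserves the relation. -/
theorem exists_eq_permute (hirr : ∀ i, ¬ R i i)
    (hinj : Function.Injective (neighbourSum k R)) (f : Aut k (RelAlgebra k R)) :
    ∃ σ : Equiv.Perm ι, (∀ i j, R (σ i) (σ j) ↔ R i j) ∧
      (f : RelAlgebra k R ≃ₗ[k] RelAlgebra k R) = permute R σ := by
  classical
  have h1 (i : ι) : ∃ j, ∃ c : k, c ≠ 0 ∧
      (f : RelAlgebra k R ≃ₗ[k] RelAlgebra k R) (stdBasis i) = c • stdBasis j :=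
    exists_eq_smul_stdBasis hinj
      ⟨_, isNaturalBasis_range_stdBasis.image f, _, ⟨i, rfl⟩, rfl⟩
  choose σ c hc hf using h1
  have hσ : Function.Injective σ := by
    intro i j hij
    by_contra hne
    have h : (f : RelAlgebra k R ≃ₗ[k] RelAlgebra k R) (c j • stdBasis i) =
        (f : RelAlgebra k R ≃ₗ[k] RelAlgebra k R) (c i • stdBasis j) := by
      rw [map_smul, map_smul, hf, hf, hij, smul_comm]
    have h := congrFun ((f : RelAlgebra k R ≃ₗ[k] RelAlgebra k R).injective h) i
    change c j * (stdBasis i : RelAlgebra k R) i = c i * (stdBasis j : RelAlgebra k R) i at h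
    rw [stdBasis_self, stdBasis_of_ne (Ne.symm hne), mul_one, mul_zero] at h
    exact hc j h
  let τ : Equiv.Perm ι := Equiv.ofBijective σ (Finite.injective_iff_bijective.mp hσ)
  have hcoord (x : RelAlgebra k R) (m : ι) :
      (f : RelAlgebra k R ≃ₗ[k] RelAlgebra k R) x (σ m) = c m * x m := by
    have h : stdBasis.coord (σ m) ∘ₗ
        ((f : RelAlgebra k R ≃ₗ[k] RelAlgebra k R) : RelAlgebra k R →ₗ[k] RelAlgebra k R) =
        c m • stdBasis.coord m := by
      refine stdBasis.ext fun i => ?_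
      simp only [LinearMap.comp_apply, LinearEquiv.coe_coe, hf, LinearMap.smul_apply, map_smul,
        Module.Basis.coord_apply, repr_eq, smul_eq_mul]
      by_cases him : i = m
      · rw [him, stdBasis_self, stdBasis_self]
      · rw [stdBasis_of_ne him, stdBasis_of_ne (fun e => him (hσ e)), mul_zero, mul_zero]
    have h := LinearMap.congr_fun h x
    simpa only [LinearMap.comp_apply, LinearEquiv.coe_coe, LinearMap.smul_apply,
      Module.Basis.coord_apply, repr_eq, smul_eq_mul] using h
  -- Coordinate `σ m` of f(e_i²) = f(e_i)²; the case m = i gives c_i = c_i².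
  have hrel (i m : ι) : c m * ((if i = m then 1 else 0) + if R i m then 1 else 0) =
      c i * (c i * ((if i = m then 1 else 0) + if R (σ i) (σ m) then 1 else 0)) := by
    have h := congrFun (f.2 (stdBasis i) (stdBasis i)) (σ m)
    rw [hf, smul_mul_assoc, mul_smul_comm, hcoord] at h
    change _ = c i * (c i * (stdBasis (σ i) * stdBasis (σ i) : RelAlgebra k R) (σ m)) at h
    rw [stdBasis_mul_self_apply, stdBasis_mul_self_apply] at h
    simpa only [hσ.eq_iff] using h
  have hc1 (i : ι) : c i = 1 := by
    have h := hrel i i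
    simp only [if_true, hirr, if_false, add_zero, mul_one] at h
    exact mul_left_cancel₀ (hc i) (h.symm.trans (mul_one _).symm)
  refine ⟨τ, fun i m => ?_, ?_⟩
  · change R (σ i) (σ m) ↔ R i m
    by_cases him : i = m
    · subst him
      simp [hirr]
    · have h := hrel i m
      simp only [hc1, him, if_false, zero_add, one_mul] at h
      by_cases ha : R i m <;> by_cases hb : R (σ i) (σ m) <;> simp_all
  · refine LinearEquiv.toLinearMap_injective (stdBasis.ext fun i => ?_)
    simp only [LinearEquiv.coe_coe]
    rw [hf, hc1, one_smul, permute_stdBasis]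
    rfl

theorem finrank_eq : Module.finrank k (RelAlgebra k R) = Fintype.card ι :=
  Module.finrank_fintype_fun_eq_card k

/-- A group acting faithfully on a finite acyclic relation as its full automorphism group is the
automorphism group of the associated algebra, compatibly with the action on the sinks. -/
theorem exists_mulEquiv_aut {G V : Type*} [Group G] [MulAction G V] (ℓ : ι → ℕ)
    (hℓ : ∀ i j, R i j → ℓ j < ℓ i) (a : G →* Equiv.Perm ι) (ha : Function.Injective a)
    (hrange : ∀ σ : Equiv.Perm ι, (∀ i j, R (σ i) (σ j) ↔ R i j) ↔ ∃ g, a g = σ)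
    (s : V → ι) (hs : Function.Injective s) (hsink : ∀ i, (∀ j, ¬ R i j) ↔ ∃ v, s v = i)
    (hsa : ∀ g v, a g (s v) = s (g • v)) :
    ∃ (φ : G ≃* Aut k (RelAlgebra k R)) (e : V ≃ naturalIdempotents k (RelAlgebra k R)),
      ∀ g v, naturalIdempotentRep k (RelAlgebra k R) (φ g) (e v) = e (g • v) := by
  have hinj := neighbourSum_injective (k := k) ℓ hℓ
  have hirr (i : ι) : ¬ R i i := fun h => (hℓ i i h).false
  let φ : G →* Aut k (RelAlgebra k R) :=
    { toFun g := ⟨permute R (a g), permute_mem_aut ((hrange _).mpr ⟨g, rfl⟩)⟩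
      map_one' := by
        refine Subtype.ext (LinearEquiv.ext fun x => funext fun i => ?_)
        change x ((a 1).symm i) = x i
        rw [map_one]
        rfl
      map_mul' g h := by
        refine Subtype.ext (LinearEquiv.ext fun x => funext fun i => ?_)
        change x ((a (g * h)).symm i) = x ((a h).symm ((a g).symm i))
        rw [map_mul]
        rfl }
  have hφ (g : G) (i : ι) :
      (φ g : RelAlgebra k R ≃ₗ[k] RelAlgebra k R) (stdBasis i) = stdBasis (a g i) :=
    permute_stdBasis _ _
  have hstd : Function.Injective (stdBasis : ι → RelAlgebra k R) := stdBasis.injective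
  have hφbij : Function.Bijective φ := by
    constructor
    · intro g h hgh
      refine ha (Equiv.ext fun i => hstd ?_)
      rw [← hφ, ← hφ, hgh]
    · intro f
      obtain ⟨σ, hσ, hf⟩ := exists_eq_permute hirr hinj f
      obtain ⟨g, rfl⟩ := (hrange σ).mp hσ
      exact ⟨g, Subtype.ext hf.symm⟩
  let e : V → naturalIdempotents k (RelAlgebra k R) := fun v =>
    ⟨stdBasis (s v), (mem_naturalIdempotents_iff hirr hinj).mpr
      ⟨s v, (hsink _).mpr ⟨v, rfl⟩, rfl⟩⟩
  have he : Function.Bijective e := by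
    constructor
    · intro v w h
      exact hs (hstd (congrArg Subtype.val h))
    · rintro ⟨x, hx⟩
      obtain ⟨i, hi, rfl⟩ := (mem_naturalIdempotents_iff hirr hinj).mp hx
      obtain ⟨v, rfl⟩ := (hsink i).mp hi
      exact ⟨v, rfl⟩
  refine ⟨MulEquiv.ofBijective φ hφbij, Equiv.ofBijective e he, fun g v => Subtype.ext ?_⟩
  change (φ g : RelAlgebra k R ≃ₗ[k] RelAlgebra k R) (stdBasis (s v)) = stdBasis (s (g • v))
  rw [hφ, hsa]

end RelAlgebra

/-! ### Layered relations and their automorphisms -/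

/-- A permutation preserving a relation preserves every height function with the property that
each element of positive height has a neighbour exactly one step below. -/
theorem height_apply_eq {ι : Type*} {R : ι → ι → Prop} (ℓ : ι → ℕ)
    (hℓ : ∀ i j, R i j → ℓ j < ℓ i) (hstep : ∀ i, ℓ i ≠ 0 → ∃ j, R i j ∧ ℓ j + 1 = ℓ i)
    {σ : Equiv.Perm ι} (hσ : ∀ i j, R (σ i) (σ j) ↔ R i j) (i : ι) : ℓ (σ i) = ℓ i := by
  -- Stated for all `τ` so as to apply to `σ` and its inverse, giving both inequalities.
  have key : ∀ τ : Equiv.Perm ι, (∀ i j, R (τ i) (τ j) ↔ R i j) →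
      ∀ n i, ℓ i = n → n ≤ ℓ (τ i) := by
    intro τ hτ n
    induction n with
    | zero => exact fun _ _ => Nat.zero_le _
    | succ n ih =>
      intro i hi
      obtain ⟨j, hij, hj⟩ := hstep i (by omega)
      have h1 := ih j (by omega)
      have h2 := hℓ _ _ ((hτ i j).mpr hij)
      omega
  have h1 := key σ hσ _ i rfl
  have h2 := key σ.symm (fun i j => by rw [← hσ]; simp) _ (σ i) rfl
  rw [Equiv.symm_apply_apply] at h2
  exact le_antisymm h2 h1

section LayeredRelation

variable {G V : Type*} [Group G] [MulAction G V] {N : ℕ}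

/-- The points of a layered relation: a bottom layer `V` and `N` copies of `G`. -/
abbrev LayeredPoint (G V : Type*) (N : ℕ) := V ⊕ (G × Fin N)

/-- Given a sequence `t` of labels in `V ⊕ G`, the point `(g, i)` is related to the point below it
in the layer `i - 1` and to the translate by `g` of the label `t i`, the group `G` being viewed
as the layer `0`. -/
def layeredRel (t : ℕ → V ⊕ G) : LayeredPoint G V N → LayeredPoint G V N → Prop
  | .inl _, _ => False
  | .inr (g, i), .inl v => ∃ u, t i = .inl u ∧ v = g • u
  | .inr (g, i), .inr (g', j) =>
      (g' = g ∧ (j : ℕ) + 1 = i) ∨ ∃ h, t i = .inr h ∧ g' = g * h ∧ (j : ℕ) = 0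

/-- The height of a point of the layered relation. -/
def layeredHeight : LayeredPoint G V N → ℕ
  | .inl _ => 0
  | .inr (_, i) => i + 1

/-- The action of the group on the points, by left translation on the copies of `G`. -/
def layeredAction (G V : Type*) [Group G] [MulAction G V] (N : ℕ) :
    G →* Equiv.Perm (LayeredPoint G V N) where
  toFun g := Equiv.sumCongr (MulAction.toPerm g) (Equiv.prodCongr (Equiv.mulLeft g) (Equiv.refl _))
  map_one' := by
    ext (v | ⟨h, i⟩) <;> simp
  map_mul' g g' := by
    ext (v | ⟨h, i⟩) <;> simp [mul_smul, mul_assoc]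

theorem layeredAction_inl (g : G) (v : V) :
    layeredAction G V N g (.inl v) = .inl (g • v) := rfl

theorem layeredAction_inr (g h : G) (i : Fin N) :
    layeredAction G V N g (.inr (h, i)) = .inr (g * h, i) := rfl

/-- A label in `G` on layer 0 would create edges inside that layer; `h0` excludes this. -/
theorem layeredHeight_lt {t : ℕ → V ⊕ G} (h0 : ∃ u, t 0 = .inl u) (p q : LayeredPoint G V N)
    (h : layeredRel t p q) : layeredHeight q < layeredHeight p := by
  obtain ⟨u₀, h0⟩ := h0
  rcases p with v | ⟨g, i⟩
  · exact h.elim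
  rcases q with w | ⟨g', j⟩
  · exact Nat.succ_pos _
  · simp only [layeredHeight]
    rcases h with ⟨-, h⟩ | ⟨x, h, -, h'⟩
    · omega
    · have : (i : ℕ) ≠ 0 := by
        intro e
        rw [e, h0] at h
        cases h
      omega

theorem exists_layeredHeight_succ {t : ℕ → V ⊕ G} (h0 : ∃ u, t 0 = .inl u)
    (p : LayeredPoint G V N) (hp : layeredHeight p ≠ 0) :
    ∃ q, layeredRel t p q ∧ layeredHeight q + 1 = layeredHeight p := by
  obtain ⟨u₀, h0⟩ := h0
  rcases p with v | ⟨g, i, hi⟩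
  · exact (hp rfl).elim
  rcases i with _ | i
  · exact ⟨.inl (g • u₀), ⟨u₀, h0, rfl⟩, rfl⟩
  · exact ⟨.inr (g, ⟨i, by omega⟩), .inl ⟨rfl, rfl⟩, rfl⟩

theorem layeredRel_layeredAction {t : ℕ → V ⊕ G} (g : G) (p q : LayeredPoint G V N) :
    layeredRel t (layeredAction G V N g p) (layeredAction G V N g q) ↔ layeredRel t p q := by
  rcases p with v | ⟨h, i⟩
  · exact Iff.rfl
  rcases q with w | ⟨h', j⟩
  · simp only [layeredAction_inl, layeredAction_inr, layeredRel, mul_smul, smul_left_cancel_iff]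
  · simp only [layeredAction_inr, layeredRel, mul_assoc, mul_right_inj]

/-- If the labels begin with two elements of `V` and exhaust `V ⊕ G`, every automorphism of the
layered relation is a translation. -/
theorem exists_eq_layeredAction {t : ℕ → V ⊕ G} (h0 : ∃ u, t 0 = .inl u)
    (h1 : ∃ u, t 1 = .inl u) (ht : ∀ x, ∃ i < N, t i = x)
    {σ : Equiv.Perm (LayeredPoint G V N)}
    (hσ : ∀ p q, layeredRel t (σ p) (σ q) ↔ layeredRel t p q) :
    ∃ g, layeredAction G V N g = σ := by
  have hheight := height_apply_eq layeredHeight (layeredHeight_lt h0)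
    (exists_layeredHeight_succ h0) hσ
  have hV (v : V) : ∃ w : V, σ (.inl v) = .inl w := by
    have h := hheight (.inl v)
    rcases hw : σ (.inl v) with w | ⟨g, i⟩
    · exact ⟨w, rfl⟩
    · rw [hw] at h
      simp [layeredHeight] at h
  have hG (g : G) (i : Fin N) : ∃ g' : G, σ (.inr (g, i)) = .inr (g', i) := by
    have h := hheight (.inr (g, i))
    rcases hw : σ (.inr (g, i)) with w | ⟨g', j⟩
    · rw [hw] at h
      simp [layeredHeight] at h
    · rw [hw] at h
      simp only [layeredHeight, add_left_inj, Fin.val_inj] at h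
      exact ⟨g', by rw [h]⟩
  choose τ hτ using hV
  choose s hs using hG
  obtain ⟨u₁, h1⟩ := h1
  obtain ⟨N', rfl⟩ : ∃ N', N = N' + 1 := by
    obtain ⟨i, hi, -⟩ := ht (.inr 1)
    exact ⟨N - 1, by omega⟩
  have hlayer (g : G) : ∀ (i : ℕ) (hi : i < N' + 1), s g ⟨i, hi⟩ = s g 0 := by
    intro i
    induction i with
    | zero => exact fun _ => rfl
    | succ i ih =>
      intro hi
      have h : layeredRel t (.inr (g, ⟨i + 1, hi⟩) : LayeredPoint G V (N' + 1))
          (.inr (g, ⟨i, by omega⟩)) := .inl ⟨rfl, rfl⟩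
      rw [← hσ, hs, hs] at h
      rcases h with ⟨h, -⟩ | ⟨x, h, -, h'⟩
      · rw [← h, ih]
      -- Only between layers 1 and 0 could a label edge pass for a vertical one; `h1` rules this
      -- out.
      · obtain rfl : i = 0 := h'
        simp only [zero_add, h1] at h
        cases h
  have hmul (g h : G) : s (g * h) 0 = s g 0 * h := by
    obtain ⟨i, hi, hti⟩ := ht (.inr h)
    have hr : layeredRel t (.inr (g, ⟨i, hi⟩) : LayeredPoint G V (N' + 1))
        (.inr (g * h, 0)) := .inr ⟨h, hti, rfl, rfl⟩
    rw [← hσ, hs, hs] at hr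
    rcases hr with ⟨-, hr⟩ | ⟨x, hx, hr, -⟩
    -- A vertical edge into layer 0 starts in layer 1, whose label lies in `V`, not in `G`.
    · obtain rfl : i = 1 := by simpa using hr.symm
      rw [h1] at hti
      cases hti
    · obtain rfl : h = x := Sum.inr_injective (hti.symm.trans hx)
      rw [hr, hlayer]
  have hsmul (u : V) : τ u = s 1 0 • u := by
    obtain ⟨i, hi, hti⟩ := ht (.inl u)
    have hr : layeredRel t (.inr (1, ⟨i, hi⟩) : LayeredPoint G V (N' + 1)) (.inl u) :=
      ⟨u, hti, (one_smul G u).symm⟩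
    rw [← hσ, hs, hτ] at hr
    obtain ⟨x, hx, hr⟩ := hr
    obtain rfl : u = x := Sum.inl_injective (hti.symm.trans hx)
    rw [hr, hlayer]
  refine ⟨s 1 0, Equiv.ext fun p => ?_⟩
  rcases p with v | ⟨g, i⟩
  · rw [layeredAction_inl, hτ, hsmul]
  · rw [layeredAction_inr, hs, hlayer g i i.2, ← hmul, one_mul]

theorem layeredAction_injective (hN : 0 < N) : Function.Injective (layeredAction G V N) := by
  intro g h hgh
  have e := congrArg (fun σ => σ (.inr (1, ⟨0, hN⟩))) hgh
  simpa [layeredAction_inr] using e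

theorem layeredRel_sink_iff {t : ℕ → V ⊕ G} (h0 : ∃ u, t 0 = .inl u) (p : LayeredPoint G V N) :
    (∀ q, ¬ layeredRel t p q) ↔ ∃ v, .inl v = p := by
  constructor
  · intro h
    rcases p with v | p
    · exact ⟨v, rfl⟩
    · obtain ⟨q, hq, -⟩ := exists_layeredHeight_succ h0 (.inr p) (Nat.succ_ne_zero _)
      exact (h q hq).elim
  · rintro ⟨v, rfl⟩ q h
    exact h

/-- A sequence of labels that begins with two elements of `V` and soon exhausts `V ⊕ G`. -/
theorem exists_labels (G V : Type*) [Finite G] [Finite V] [Nonempty V] :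
    ∃ t : ℕ → V ⊕ G, (∃ u, t 0 = .inl u) ∧ (∃ u, t 1 = .inl u) ∧
      ∃ M, ∀ x, ∃ i < M, t i = x := by
  let v : V := Classical.arbitrary V
  let m := Nat.card (V ⊕ G)
  let T : V ⊕ G ≃ Fin m := Finite.equivFin _
  -- The enumeration is shifted by two to leave room for the two initial labels in `V`; `v` also
  -- pads the tail, so any larger `N` works.
  refine ⟨fun i => if h : 2 ≤ i ∧ i - 2 < m then T.symm ⟨i - 2, h.2⟩ else .inl v,
    ⟨v, by simp⟩, ⟨v, by simp⟩, m + 2, fun x => ⟨T x + 2, by omega, ?_⟩⟩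
  simp

end LayeredRelation

/-! ### Realisation in infinitely many dimensions -/

/-- An action of a finite group on a finite set is the action of the full automorphism group of
an idempotent evolution algebra on its natural idempotents, in infinitely many dimensions. -/
theorem exists_relAlgebra (k : Type u) [Field k] (G : Type v) [Group G] [Finite G]
    (V : Type w) [Finite V] [Nonempty V] [MulAction G V] :
    ∃ M : ℕ, ∀ N, M ≤ N → ∃ (R : Fin (Nat.card V + Nat.card G * N) → _ → Prop),
      IsIdempotentAlgebra k (RelAlgebra k R) ∧
        ∃ (φ : G ≃* Aut k (RelAlgebra k R)) (e : V ≃ naturalIdempotents k (RelAlgebra k R)),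
          ∀ g v, naturalIdempotentRep k (RelAlgebra k R) (φ g) (e v) = e (g • v) := by
  obtain ⟨t, h0, h1, M, hM⟩ := exists_labels G V
  refine ⟨M, fun N hN => ?_⟩
  have ht (x : V ⊕ G) : ∃ i < N, t i = x := by
    obtain ⟨i, hi, h⟩ := hM x
    exact ⟨i, hi.trans_le hN, h⟩
  have hN0 : 0 < N := by
    obtain ⟨i, hi, -⟩ := ht (.inr 1)
    omega
  have hcard : Nat.card (LayeredPoint G V N) = Nat.card V + Nat.card G * N := by
    rw [Nat.card_sum, Nat.card_prod, Nat.card_fin]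
  -- Indexing by `Fin` keeps the algebra in the universe of `k`, whatever those of `G` and `V`.
  let E : LayeredPoint G V N ≃ Fin (Nat.card V + Nat.card G * N) := Finite.equivFinOfCardEq hcard
  let ℓ : Fin (Nat.card V + Nat.card G * N) → ℕ := fun i => layeredHeight (E.symm i)
  have hℓ (i j) (h : layeredRel t (E.symm i) (E.symm j)) : ℓ j < ℓ i :=
    layeredHeight_lt h0 _ _ h
  refine ⟨fun i j => layeredRel t (E.symm i) (E.symm j),
    RelAlgebra.isIdempotentAlgebra (RelAlgebra.neighbourSum_injective ℓ hℓ), ?_⟩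
  refine RelAlgebra.exists_mulEquiv_aut ℓ hℓ
    (E.permCongrHom.toMonoidHom.comp (layeredAction G V N))
    (E.permCongrHom.injective.comp (layeredAction_injective hN0)) (fun σ => ?_)
    (fun v => E (.inl v)) (fun v w h => Sum.inl_injective (E.injective h)) (fun i => ?_)
    (fun g v => ?_)
  · constructor
    · intro hσ
      obtain ⟨g, hg⟩ := exists_eq_layeredAction h0 h1 ht (σ := E.symm.permCongr σ)
        (fun p q => by simpa using hσ (E p) (E q))
      exact ⟨g, Equiv.ext fun i => by simp [hg]⟩
    · rintro ⟨g, rfl⟩ i j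
      simpa using layeredRel_layeredAction g (E.symm i) (E.symm j)
  · rw [E.symm.forall_congr_left]
    simpa [← Equiv.eq_symm_apply] using layeredRel_sink_iff h0 (E.symm i)
  · simp [layeredAction_inl]

end EvolutionAlgebra

theorem theoremC (k : Type u) [Field k] (G : Type v) [Group G] [Finite G]
    (V : Type w) [Finite V] [Nonempty V] (ξ : G →* Equiv.Perm V) :
    ∃ X : ℕ → EvolutionAlgebra k,
      (∀ i j, i ≠ j → ¬ EvolutionAlgebra.Isomorphic k (X i).carrier (X j).carrier) ∧
      ∀ i, EvolutionAlgebra.IsIdempotentAlgebra k (X i).carrier ∧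
        ∃ (φ : G ≃* EvolutionAlgebra.Aut k (X i).carrier)
          (e : V ≃ EvolutionAlgebra.naturalIdempotents k (X i).carrier),
          ∀ (g : G) (v : V),
            EvolutionAlgebra.naturalIdempotentRep k (X i).carrier (φ g) (e v) = e (ξ g v) := by
  let _ : MulAction G V := MulAction.compHom V ξ
  obtain ⟨M, hM⟩ := EvolutionAlgebra.exists_relAlgebra k G V
  choose R hidem φ e he using fun n => hM (M + n) (Nat.le_add_right M n)
  refine ⟨fun n => ⟨EvolutionAlgebra.RelAlgebra k (R n),
    ⟨_, EvolutionAlgebra.RelAlgebra.isNaturalBasis_range_stdBasis⟩⟩, ?_,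
    fun n => ⟨hidem n, φ n, e n, he n⟩⟩
  rintro i j hij ⟨f, -⟩
  have h := f.finrank_eq
  rw [EvolutionAlgebra.RelAlgebra.finrank_eq, EvolutionAlgebra.RelAlgebra.finrank_eq,
    Fintype.card_fin, Fintype.card_fin] at h
  have hG : 0 < Nat.card G := Nat.card_pos
  have h := Nat.eq_of_mul_eq_mul_left hG (Nat.add_left_cancel h)
  omega
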